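/- Fix $N\in\mathbb N$. For $\varphi:\mathbb R^N\to\mathbb R$ with compact support let $s(\varphi)=\inf\{\varepsilon>0:\operatorname{supp}\varphi\subset B_\varepsilon(0)\}$. A delta sequence is a sequence $(\delta_m)$ of nonnegative smooth functions on $\mathbb R^N$ with compact support such that $\int\delta_m=1$ for every $m$ and $s(\delta_m)\to0$. For an open set $U\subseteq\mathbb R^N$, let $\mathscr C(U)$ be the space of continuous functions $U\to\mathbb R$. For $f\in\mathscr C(U)$ and a test function $\varphi$ put $(f*\varphi)(x)=\int f(y)\varphi(x-y)\,dy$, which is defined at every $x$ with $x-\operatorname{supp}\varphi\subseteq U$ (the integrand being $0$ where $\varphi(x-y)=0$). A sequence $(f_n)$ in $\mathscr C(U)$ is called fundamental on $U$ if for every compact $K\subseteq U$ there is a delta sequence $(\delta_m)$ such that, for every $m$, the functions $f_n*\delta_m$ are defined on $K$ and converge uniformly on $K$ as $n\to\infty$. Two fundamental sequences $(f_n),(g_n)$ on $U$ are equivalent if for every compact $K\subseteq U$ there is a delta sequence $(\varphi_m)$ such that, for every $m$, the functions $(f_n-g_n)*\varphi_m$ are defined on $K$ and converge to $0$ uniformly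 on $K$ as $n\to\infty$. This is an equivalence relation. The set $\mathfrak B(U)$ of Boehmians on $U$ is the set of equivalence classes $[(f_n)]$ of fundamental sequences on $U$. For an open set $V\subseteq U$, the restriction to $V$ of $F=[(f_n)]\in\mathfrak B(U)$ is $F|_V=[(f_n|_V)]\in\mathfrak B(V)$, which is well defined. Let $U_1,\dots,U_n$ be finitely many open subsets of $\mathbb R^N$ and let $F_i\in\mathfrak B(U_i)$ for $i=1,\dots,n$ be such that $F_i|_{U_i\cap U_j}=F_j|_{U_i\cap U_j}$ for all $i,j$. Then there is $F\in\mathfrak B\bigl(\bigcup_{i=1}^n U_i\bigr)$ with $F|_{U_i}=F_i$ for every $i=1,\dots,n$. -/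

import Mathlib

open TopologicalSpace Filter Topology MeasureTheory
open scoped ContDiff

namespace Boehmian

/-- `s(φ)`, the infimum of all `ε > 0` such that the closed support of `φ` lies in the open ball
of radius `ε` about the origin. -/
noncomputable def suppRadius {N : ℕ} (φ : EuclideanSpace ℝ (Fin N) → ℝ) : ℝ :=
  sInf {ε : ℝ | 0 < ε ∧ tsupport φ ⊆ Metric.ball 0 ε}

/-- The class of nonnegative test functions (smooth, compactly supported) of integral one. -/
structure IsUnitTest {N : ℕ} (φ : EuclideanSpace ℝ (Fin N) → ℝ) : Prop where
  smooth : ContDiff ℝ ∞ φ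
  compactSupport : HasCompactSupport φ
  nonneg : ∀ x, 0 ≤ φ x
  integral_eq_one : ∫ x, φ x = 1

/-- Delta sequences. -/
structure IsDelta {N : ℕ} (δ : ℕ → EuclideanSpace ℝ (Fin N) → ℝ) : Prop where
  unitTest : ∀ n, IsUnitTest (δ n)
  tendsto_suppRadius : Tendsto (fun n => suppRadius (δ n)) atTop (𝓝 0)

/-- The convolution `x ↦ ∫ f(y) φ(x - y) dy` of a continuous function `f` on `U` with `φ`. The
product `f(y) φ(x - y)` is read as `0` where `f` is not defined, so this is meaningful at those
`x` for which `x - supp φ ⊆ U`; see `ConvDefinedOn`. -/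
noncomputable def conv {N : ℕ} {U : Opens (EuclideanSpace ℝ (Fin N))} (f : C(U, ℝ))
    (φ : EuclideanSpace ℝ (Fin N) → ℝ) : EuclideanSpace ℝ (Fin N) → ℝ :=
  convolution (Function.extend Subtype.val f 0) φ (ContinuousLinearMap.mul ℝ ℝ) volume

/-- The convolution with `φ` of functions given on `U` is defined at every point of `K`. -/
def ConvDefinedOn {N : ℕ} (U : Opens (EuclideanSpace ℝ (Fin N)))
    (φ : EuclideanSpace ℝ (Fin N) → ℝ) (K : Set (EuclideanSpace ℝ (Fin N))) : Prop :=
  ∀ x ∈ K, ∀ y ∈ tsupport φ, x - y ∈ U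

/-- Fundamental sequences of continuous functions on `U`. Discarding finitely many terms of a delta
sequence gives a delta sequence, so one may ask that all the convolutions be defined on `K`. -/
def IsFundamental {N : ℕ} {U : Opens (EuclideanSpace ℝ (Fin N))} (f : ℕ → C(U, ℝ)) : Prop :=
  ∀ K : Set (EuclideanSpace ℝ (Fin N)), IsCompact K → K ⊆ U →
    ∃ δ : ℕ → EuclideanSpace ℝ (Fin N) → ℝ, IsDelta δ ∧ ∀ m, ConvDefinedOn U (δ m) K ∧
      ∃ g : EuclideanSpace ℝ (Fin N) → ℝ,
        TendstoUniformlyOn (fun n => conv (f n) (δ m)) g atTop K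

/-- The relation `∼` between sequences of continuous functions on `U`. -/
def Equivalent {N : ℕ} {U : Opens (EuclideanSpace ℝ (Fin N))} (f g : ℕ → C(U, ℝ)) : Prop :=
  ∀ K : Set (EuclideanSpace ℝ (Fin N)), IsCompact K → K ⊆ U →
    ∃ φ : ℕ → EuclideanSpace ℝ (Fin N) → ℝ, IsDelta φ ∧ ∀ m, ConvDefinedOn U (φ m) K ∧
      TendstoUniformlyOn (fun n => conv (f n - g n) (φ m)) 0 atTop K

/-- The set of fundamental sequences on `U`, as a type. -/
def FundSeq {N : ℕ} (U : Opens (EuclideanSpace ℝ (Fin N))) : Type :=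
  {f : ℕ → C(U, ℝ) // IsFundamental f}

theorem tsupport_subset_of_suppRadius_lt {N : ℕ} {φ : EuclideanSpace ℝ (Fin N) → ℝ}
    (hφ : HasCompactSupport φ) {ε : ℝ} (h : suppRadius φ < ε) :
    tsupport φ ⊆ Metric.ball 0 ε := by
  have hne : {ε : ℝ | 0 < ε ∧ tsupport φ ⊆ Metric.ball 0 ε}.Nonempty := by
    obtain ⟨r, hr, hr'⟩ := hφ.isCompact.isBounded.subset_ball_lt 0 0
    exact ⟨r, hr, hr'⟩
  obtain ⟨r, hr, hr'⟩ := exists_lt_of_csInf_lt hne h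
  exact hr.2.trans (Metric.ball_subset_ball hr'.le)

theorem suppRadius_nonneg {N : ℕ} (φ : EuclideanSpace ℝ (Fin N) → ℝ) : 0 ≤ suppRadius φ :=
  Real.sInf_nonneg fun _ h => h.1.le

theorem suppRadius_le {N : ℕ} {φ : EuclideanSpace ℝ (Fin N) → ℝ} {ε : ℝ} (hε : 0 < ε)
    (h : tsupport φ ⊆ Metric.ball 0 ε) : suppRadius φ ≤ ε :=
  csInf_le ⟨0, fun _ h => h.1.le⟩ ⟨hε, h⟩

theorem IsDelta.eventually_tsupport {N : ℕ} {δ : ℕ → EuclideanSpace ℝ (Fin N) → ℝ}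
    (hδ : IsDelta δ) {ε : ℝ} (hε : 0 < ε) : ∀ᶠ n in atTop, tsupport (δ n) ⊆ Metric.ball 0 ε := by
  filter_upwards [hδ.tendsto_suppRadius.eventually_lt_const hε] with n hn
  exact tsupport_subset_of_suppRadius_lt (hδ.unitTest n).compactSupport hn

theorem IsDelta.tail {N : ℕ} {δ : ℕ → EuclideanSpace ℝ (Fin N) → ℝ} (hδ : IsDelta δ) (k : ℕ) :
    IsDelta fun n => δ (n + k) :=
  ⟨fun _ => hδ.unitTest _, hδ.tendsto_suppRadius.comp (tendsto_add_atTop_nat k)⟩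

theorem IsUnitTest.convolution_right {N : ℕ} {φ ψ : EuclideanSpace ℝ (Fin N) → ℝ} (hφ : IsUnitTest φ)
    (hψ : IsUnitTest ψ) :
    IsUnitTest (convolution φ ψ (ContinuousLinearMap.mul ℝ ℝ) volume) where
  smooth := hψ.compactSupport.contDiff_convolution_right _
    hφ.smooth.continuous.locallyIntegrable hψ.smooth
  compactSupport := hφ.compactSupport.convolution _ hψ.compactSupport
  nonneg x := integral_nonneg fun t => mul_nonneg (hφ.nonneg _) (hψ.nonneg _)
  integral_eq_one := by
    have h := integral_convolution (ContinuousLinearMap.mul ℝ ℝ) (μ := volume) (ν := volume)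
      (hφ.smooth.continuous.integrable_of_hasCompactSupport hφ.compactSupport)
      (hψ.smooth.continuous.integrable_of_hasCompactSupport hψ.compactSupport)
    rw [hφ.integral_eq_one, hψ.integral_eq_one] at h
    exact h.trans (mul_one 1)

theorem tsupport_convolution_subset {N : ℕ} {φ ψ : EuclideanSpace ℝ (Fin N) → ℝ}
    (hφ : HasCompactSupport φ) (hψ : HasCompactSupport ψ) {z : EuclideanSpace ℝ (Fin N)}
    (hz : z ∈ tsupport (convolution φ ψ (ContinuousLinearMap.mul ℝ ℝ) volume)) :
    ∃ a ∈ tsupport φ, ∃ b ∈ tsupport ψ, a + b = z := by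
  have hc : IsClosed (Set.image2 (fun a b => a + b) (tsupport φ) (tsupport ψ)) :=
    (hφ.isCompact.add hψ.isCompact).isClosed
  have hsub := closure_minimal ((support_convolution_subset_swap
    (ContinuousLinearMap.mul ℝ ℝ) (f := φ) (g := ψ) (μ := volume)).trans ?_) hc
  · exact hsub hz
  · rintro _ ⟨b, hb, a, ha, rfl⟩
    exact ⟨a, subset_tsupport _ ha, b, subset_tsupport _ hb, add_comm _ _⟩

theorem IsDelta.convolution_right {N : ℕ} {φ ψ : ℕ → EuclideanSpace ℝ (Fin N) → ℝ} (hφ : IsDelta φ)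
    (hψ : IsDelta ψ) :
    IsDelta fun n => convolution (φ n) (ψ n) (ContinuousLinearMap.mul ℝ ℝ) volume where
  unitTest n := (hφ.unitTest n).convolution_right (hψ.unitTest n)
  tendsto_suppRadius := by
    rw [Metric.tendsto_atTop']
    intro ε hε
    have h := (hφ.eventually_tsupport (show 0 < ε / 4 by positivity)).and
      (hψ.eventually_tsupport (show 0 < ε / 4 by positivity))
    obtain ⟨n₀, hn₀⟩ := eventually_atTop.1 h
    refine ⟨n₀, fun n hn => ?_⟩
    rw [Real.dist_0_eq_abs, abs_of_nonneg (suppRadius_nonneg _)]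
    refine (suppRadius_le (show 0 < ε / 2 by positivity) fun z hz => ?_).trans_lt (by linarith)
    obtain ⟨a, ha, b, hb, rfl⟩ := tsupport_convolution_subset (hφ.unitTest n).compactSupport
      (hψ.unitTest n).compactSupport hz
    have h1 := mem_ball_zero_iff.1 ((hn₀ n hn.le).1 ha)
    have h2 := mem_ball_zero_iff.1 ((hn₀ n hn.le).2 hb)
    exact mem_ball_zero_iff.2 ((norm_add_le a b).trans_lt (by linarith))

theorem IsDelta.eventually_convDefinedOn {N : ℕ} {δ : ℕ → EuclideanSpace ℝ (Fin N) → ℝ}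
    (hδ : IsDelta δ) {U : Opens (EuclideanSpace ℝ (Fin N))} {K : Set (EuclideanSpace ℝ (Fin N))}
    (hK : IsCompact K) (hKU : K ⊆ U) : ∀ᶠ n in atTop, ConvDefinedOn U (δ n) K := by
  obtain ⟨ε, hε, h⟩ := hK.exists_thickening_subset_open U.isOpen hKU
  filter_upwards [hδ.eventually_tsupport hε] with n hn x hx y hy
  refine h (Metric.mem_thickening_iff.2 ⟨x, hx, ?_⟩)
  simpa [dist_eq_norm] using hn hy

theorem conv_apply {N : ℕ} {U : Opens (EuclideanSpace ℝ (Fin N))} (f : C(U, ℝ))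
    (φ : EuclideanSpace ℝ (Fin N) → ℝ) (x : EuclideanSpace ℝ (Fin N)) :
    conv f φ x = ∫ t, Function.extend Subtype.val f 0 t * φ (x - t) := rfl

theorem extend_of_mem {N : ℕ} {U : Opens (EuclideanSpace ℝ (Fin N))} (f : C(U, ℝ))
    {x : EuclideanSpace ℝ (Fin N)} (hx : x ∈ U) :
    Function.extend Subtype.val f 0 x = f ⟨x, hx⟩ :=
  Subtype.val_injective.extend_apply f 0 (⟨x, hx⟩ : U)

/-- Restriction of continuous functions. -/
def restrictFun {N : ℕ} {U V : Opens (EuclideanSpace ℝ (Fin N))} (h : V ≤ U) (f : C(U, ℝ)) :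
    C(V, ℝ) :=
  f.comp ⟨Set.inclusion h, continuous_inclusion h⟩

/-- The convolution at a point depends only on the values on the reflected support. -/
theorem convolution_congr_on {N : ℕ} {f g φ : EuclideanSpace ℝ (Fin N) → ℝ}
    {x : EuclideanSpace ℝ (Fin N)} (h : ∀ y ∈ tsupport φ, f (x - y) = g (x - y)) :
    convolution f φ (ContinuousLinearMap.mul ℝ ℝ) volume x =
      convolution g φ (ContinuousLinearMap.mul ℝ ℝ) volume x := by
  refine integral_congr_ae (Eventually.of_forall fun t => ?_)
  change f t * φ (x - t) = g t * φ (x - t)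
  by_cases ht : x - t ∈ tsupport φ
  · have := h _ ht
    rw [sub_sub_cancel] at this
    rw [this]
  · rw [image_eq_zero_of_notMem_tsupport ht, mul_zero, mul_zero]

theorem conv_restrictFun {N : ℕ} {U V : Opens (EuclideanSpace ℝ (Fin N))} (h : V ≤ U)
    (f : C(U, ℝ)) {φ : EuclideanSpace ℝ (Fin N) → ℝ} {K : Set (EuclideanSpace ℝ (Fin N))}
    (hd : ConvDefinedOn V φ K) {x : EuclideanSpace ℝ (Fin N)} (hx : x ∈ K) :
    conv (restrictFun h f) φ x = conv f φ x := by
  refine convolution_congr_on fun y hy => ?_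
  rw [extend_of_mem _ (hd x hx y hy), extend_of_mem _ (h (hd x hx y hy))]
  rfl

theorem IsFundamental.restrict {N : ℕ} {U V : Opens (EuclideanSpace ℝ (Fin N))} (h : V ≤ U)
    {f : ℕ → C(U, ℝ)} (hf : IsFundamental f) :
    IsFundamental fun n => restrictFun h (f n) := by
  intro K hK hKV
  obtain ⟨δ, hδ, hc⟩ := hf K hK (hKV.trans h)
  obtain ⟨k, hk⟩ := eventually_atTop.1 (hδ.eventually_convDefinedOn hK hKV)
  refine ⟨_, hδ.tail k, fun m => ⟨hk _ (Nat.le_add_left _ _), ?_⟩⟩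
  obtain ⟨g, hg⟩ := (hc (m + k)).2
  exact ⟨g, hg.congr (Eventually.of_forall fun n x hx =>
    (conv_restrictFun h (f n) (hk _ (Nat.le_add_left _ _)) hx).symm)⟩

theorem Equivalent.restrict {N : ℕ} {U V : Opens (EuclideanSpace ℝ (Fin N))} (h : V ≤ U)
    {f g : ℕ → C(U, ℝ)} (hf : Equivalent f g) :
    Equivalent (fun n => restrictFun h (f n)) (fun n => restrictFun h (g n)) := by
  intro K hK hKV
  obtain ⟨δ, hδ, hc⟩ := hf K hK (hKV.trans h)
  obtain ⟨k, hk⟩ := eventually_atTop.1 (hδ.eventually_convDefinedOn hK hKV)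
  refine ⟨_, hδ.tail k, fun m => ⟨hk _ (Nat.le_add_left _ _), ?_⟩⟩
  exact (hc (m + k)).2.congr (Eventually.of_forall fun n x hx =>
    (conv_restrictFun h (f n - g n) (hk _ (Nat.le_add_left _ _)) hx).symm)

theorem Equivalent.refl {N : ℕ} {U : Opens (EuclideanSpace ℝ (Fin N))} {f : ℕ → C(U, ℝ)}
    (hf : IsFundamental f) : Equivalent f f := by
  intro K hK hKU
  obtain ⟨δ, hδ, hc⟩ := hf K hK hKU
  refine ⟨δ, hδ, fun m => ⟨(hc m).1, ?_⟩⟩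
  have h0 : ∀ n, conv (f n - f n) (δ m) = 0 := by
    intro n
    funext x
    rw [conv_apply, sub_self]
    have h : Function.extend (Subtype.val : U → _) (⇑(0 : C(U, ℝ))) 0 = 0 :=
      Function.extend_zero _
    rw [h]
    simp
  simp only [h0]
  exact Metric.tendstoUniformlyOn_iff.2 fun ε hε =>
    Eventually.of_forall fun n x _ => by simpa using hε

theorem conv_neg {N : ℕ} {U : Opens (EuclideanSpace ℝ (Fin N))} (f : C(U, ℝ))
    (φ : EuclideanSpace ℝ (Fin N) → ℝ) {K : Set (EuclideanSpace ℝ (Fin N))}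
    (hd : ConvDefinedOn U φ K) {x : EuclideanSpace ℝ (Fin N)} (hx : x ∈ K) :
    conv (-f) φ x = -conv f φ x := by
  have h : conv (-f) φ x = convolution (fun y => -Function.extend Subtype.val f 0 y) φ
      (ContinuousLinearMap.mul ℝ ℝ) volume x := by
    refine convolution_congr_on fun y hy => ?_
    rw [extend_of_mem _ (hd x hx y hy), extend_of_mem _ (hd x hx y hy)]
    rfl
  rw [h, conv_apply, ← integral_neg]
  refine integral_congr_ae (Eventually.of_forall fun t => ?_)
  exact neg_mul _ _

theorem Equivalent.symm {N : ℕ} {U : Opens (EuclideanSpace ℝ (Fin N))} {f g : ℕ → C(U, ℝ)}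
    (h : Equivalent f g) : Equivalent g f := by
  intro K hK hKU
  obtain ⟨δ, hδ, hc⟩ := h K hK hKU
  refine ⟨δ, hδ, fun m => ⟨(hc m).1, Metric.tendstoUniformlyOn_iff.2 fun ε hε => ?_⟩⟩
  filter_upwards [Metric.tendstoUniformlyOn_iff.1 (hc m).2 ε hε] with n hn x hx
  have := hn x hx
  rw [← neg_sub, conv_neg _ _ (hc m).1 hx]
  simpa using this

theorem exists_integrable_eq {N : ℕ} {U : Opens (EuclideanSpace ℝ (Fin N))} (f : C(U, ℝ))
    {L : Set (EuclideanSpace ℝ (Fin N))} (hL : IsCompact L) (hLU : L ⊆ U) :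
    ∃ F : EuclideanSpace ℝ (Fin N) → ℝ, Integrable F ∧
      ∀ x ∈ L, F x = Function.extend Subtype.val f 0 x := by
  refine ⟨L.indicator (Function.extend Subtype.val f 0), ?_, fun x hx =>
    Set.indicator_of_mem hx _⟩
  rw [integrable_indicator_iff hL.measurableSet]
  refine ContinuousOn.integrableOn_compact hL (ContinuousOn.mono ?_ hLU)
  rw [continuousOn_iff_continuous_domRestrict]
  refine f.continuous.congr fun x => ?_
  exact (extend_of_mem f x.2).symm

/-- Convolving further with a function of integral one does not increase uniform bounds. -/
theorem abs_conv_convolution_le {N : ℕ} {U : Opens (EuclideanSpace ℝ (Fin N))} (f : C(U, ℝ))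
    {φ ψ : EuclideanSpace ℝ (Fin N) → ℝ} (hφ : IsUnitTest φ) (hψ : IsUnitTest ψ)
    {K : Set (EuclideanSpace ℝ (Fin N))} (hK : IsCompact K) (hd : ConvDefinedOn U φ K)
    {x : EuclideanSpace ℝ (Fin N)} (hx : ∀ t ∈ tsupport ψ, x - t ∈ K) {ε : ℝ}
    (hb : ∀ y ∈ K, |conv f φ y| ≤ ε) :
    |conv f (convolution φ ψ (ContinuousLinearMap.mul ℝ ℝ) volume) x| ≤ ε := by
  obtain ⟨F, hF, hFe⟩ := exists_integrable_eq f
    (L := Set.image2 (fun a b => a - b) K (tsupport φ)) (by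
      rw [← Set.image_prod]
      exact (hK.prod hφ.compactSupport.isCompact).image (by fun_prop)) (by
      rintro _ ⟨a, ha, b, hb, rfl⟩
      exact hd a ha b hb)
  have h1 : ∀ y ∈ K, convolution F φ (ContinuousLinearMap.mul ℝ ℝ) volume y = conv f φ y :=
    fun y hy => convolution_congr_on fun t ht => hFe _ ⟨y, hy, t, ht, rfl⟩
  have h2 : conv f (convolution φ ψ (ContinuousLinearMap.mul ℝ ℝ) volume) x =
      convolution F (convolution φ ψ (ContinuousLinearMap.mul ℝ ℝ) volume)
        (ContinuousLinearMap.mul ℝ ℝ) volume x := by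
    refine convolution_congr_on fun z hz => ?_
    obtain ⟨a, ha, b, hb, rfl⟩ := tsupport_convolution_subset hφ.compactSupport
      hψ.compactSupport hz
    refine (hFe _ ⟨x - b, hx b hb, a, ha, ?_⟩).symm
    change x - b - a = x - (a + b)
    abel
  have h3 := convolution_assoc (ContinuousLinearMap.mul ℝ ℝ) (ContinuousLinearMap.mul ℝ ℝ)
    (ContinuousLinearMap.mul ℝ ℝ) (ContinuousLinearMap.mul ℝ ℝ) (μ := volume) (ν := volume)
    (f := F) (g := φ) (k := ψ) (fun a b c => mul_assoc a b c) (x₀ := x)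
    hF.aestronglyMeasurable hφ.smooth.continuous.aestronglyMeasurable
    hψ.smooth.continuous.aestronglyMeasurable
    (Eventually.of_forall (hφ.compactSupport.convolutionExists_right _ hF.locallyIntegrable
      hφ.smooth.continuous))
    (Eventually.of_forall (hψ.compactSupport.norm.convolutionExists_right _
      hφ.smooth.continuous.norm.locallyIntegrable hψ.smooth.continuous.norm))
    ((hφ.compactSupport.norm.convolution _ hψ.compactSupport.norm).convolutionExists_right _
      hF.norm.locallyIntegrable (hψ.compactSupport.norm.continuous_convolution_right _
        hφ.smooth.continuous.norm.locallyIntegrable hψ.smooth.continuous.norm) x)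
  rw [h2, ← h3, convolution_eq_swap, ← Real.norm_eq_abs]
  have hi : Integrable fun t => ε * ψ t :=
    (hψ.smooth.continuous.integrable_of_hasCompactSupport hψ.compactSupport).const_mul ε
  refine (norm_integral_le_of_norm_le hi (Eventually.of_forall fun t => ?_)).trans_eq (by
    rw [integral_const_mul, hψ.integral_eq_one, mul_one])
  change ‖convolution F φ (ContinuousLinearMap.mul ℝ ℝ) volume (x - t) * ψ t‖ ≤ ε * ψ t
  by_cases ht : t ∈ tsupport ψ
  · rw [norm_mul, h1 _ (hx t ht), Real.norm_eq_abs, Real.norm_of_nonneg (hψ.nonneg t)]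
    exact mul_le_mul_of_nonneg_right (hb _ (hx t ht)) (hψ.nonneg t)
  · simp [image_eq_zero_of_notMem_tsupport ht]

theorem conv_add {N : ℕ} {U : Opens (EuclideanSpace ℝ (Fin N))} (f g : C(U, ℝ))
    {φ : EuclideanSpace ℝ (Fin N) → ℝ} (hφ : IsUnitTest φ)
    {x : EuclideanSpace ℝ (Fin N)} (hd : ConvDefinedOn U φ {x}) :
    conv (f + g) φ x = conv f φ x + conv g φ x := by
  have hL : IsCompact ((fun t => x - t) '' tsupport φ) :=
    hφ.compactSupport.isCompact.image (by fun_prop)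
  have hLU : (fun t => x - t) '' tsupport φ ⊆ U := by
    rintro _ ⟨t, ht, rfl⟩
    exact hd x rfl t ht
  obtain ⟨F, hF, hFe⟩ := exists_integrable_eq f hL hLU
  obtain ⟨G, hG, hGe⟩ := exists_integrable_eq g hL hLU
  have h1 : conv f φ x = convolution F φ (ContinuousLinearMap.mul ℝ ℝ) volume x :=
    convolution_congr_on fun t ht => (hFe _ ⟨t, ht, rfl⟩).symm
  have h2 : conv g φ x = convolution G φ (ContinuousLinearMap.mul ℝ ℝ) volume x :=
    convolution_congr_on fun t ht => (hGe _ ⟨t, ht, rfl⟩).symm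
  have h3 : conv (f + g) φ x =
      convolution (F + G) φ (ContinuousLinearMap.mul ℝ ℝ) volume x := by
    refine convolution_congr_on fun t ht => ?_
    rw [Pi.add_apply, hFe _ ⟨t, ht, rfl⟩, hGe _ ⟨t, ht, rfl⟩, extend_of_mem _ (hd x rfl t ht),
      extend_of_mem _ (hd x rfl t ht), extend_of_mem _ (hd x rfl t ht)]
    rfl
  rw [h1, h2, h3]
  exact ConvolutionExistsAt.add_distrib
    (hφ.compactSupport.convolutionExists_right _ hF.locallyIntegrable hφ.smooth.continuous x)
    (hφ.compactSupport.convolutionExists_right _ hG.locallyIntegrable hφ.smooth.continuous x)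

theorem Equivalent.trans {N : ℕ} {U : Opens (EuclideanSpace ℝ (Fin N))} {f g h : ℕ → C(U, ℝ)}
    (hfg : Equivalent f g) (hgh : Equivalent g h) : Equivalent f h := by
  intro K hK hKU
  obtain ⟨r, hr, hrU⟩ := hK.exists_cthickening_subset_open U.isOpen hKU
  have hK' : IsCompact (Metric.cthickening r K) := hK.cthickening
  obtain ⟨φ, hφ, hφc⟩ := hfg _ hK' hrU
  obtain ⟨ψ, hψ, hψc⟩ := hgh _ hK' hrU
  obtain ⟨k, hk⟩ := eventually_atTop.1 (((hφ.eventually_tsupport hr).and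
    (hψ.eventually_tsupport hr)).and
      ((hφ.convolution_right hψ).eventually_convDefinedOn hK hKU))
  refine ⟨_, (hφ.convolution_right hψ).tail k, fun m => ?_⟩
  obtain ⟨⟨hm1, hm2⟩, hm3⟩ := hk (m + k) (Nat.le_add_left _ _)
  refine ⟨hm3, Metric.tendstoUniformlyOn_iff.2 fun ε hε => ?_⟩
  have hmem : ∀ x ∈ K, ∀ t ∈ Metric.ball (0 : EuclideanSpace ℝ (Fin N)) r,
      x - t ∈ Metric.cthickening r K := by
    intro x hx t ht
    refine Metric.mem_cthickening_of_dist_le (x - t) x r K hx ?_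
    rw [dist_eq_norm, sub_sub_cancel_left, norm_neg]
    exact (mem_ball_zero_iff.1 ht).le
  filter_upwards [Metric.tendstoUniformlyOn_iff.1 (hφc (m + k)).2 (ε / 3) (by positivity),
    Metric.tendstoUniformlyOn_iff.1 (hψc (m + k)).2 (ε / 3) (by positivity)] with n hn1 hn2 x hx
  have e1 := abs_conv_convolution_le (f n - g n) (hφ.unitTest (m + k)) (hψ.unitTest (m + k)) hK'
    (hφc (m + k)).1 (x := x) (fun t ht => hmem x hx t (hm2 ht)) (ε := ε / 3)
    (fun y hy => by simpa [dist_eq_norm] using (hn1 y hy).le)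
  have e2 := abs_conv_convolution_le (g n - h n) (hψ.unitTest (m + k)) (hφ.unitTest (m + k)) hK'
    (hψc (m + k)).1 (x := x) (fun t ht => hmem x hx t (hm1 ht)) (ε := ε / 3)
    (fun y hy => by simpa [dist_eq_norm] using (hn2 y hy).le)
  have hcomm : convolution (ψ (m + k)) (φ (m + k)) (ContinuousLinearMap.mul ℝ ℝ) volume =
      convolution (φ (m + k)) (ψ (m + k)) (ContinuousLinearMap.mul ℝ ℝ) volume := by
    rw [← convolution_flip]
    congr 1
    ext
    simp
  rw [hcomm] at e2
  have hsum := conv_add (f n - g n) (g n - h n)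
    ((hφ.convolution_right hψ).unitTest (m + k)) (x := x) (by
      rintro _ rfl
      exact hm3 _ hx)
  rw [sub_add_sub_cancel] at hsum
  rw [hsum, Pi.zero_apply, dist_zero_left, Real.norm_eq_abs]
  refine (abs_add_le _ _).trans_lt ?_
  linarith

/-- Fundamental sequences with the equivalence relation `∼`. -/
def setoid {N : ℕ} (U : Opens (EuclideanSpace ℝ (Fin N))) : Setoid (FundSeq U) where
  r f g := Equivalent f.1 g.1
  iseqv := ⟨fun f => Equivalent.refl f.2, Equivalent.symm, Equivalent.trans⟩

end Boehmian

/-- The Boehmians on the open set `U`. -/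
def Boehmian {N : ℕ} (U : Opens (EuclideanSpace ℝ (Fin N))) : Type :=
  Quotient (Boehmian.setoid U)

/-- The restriction of a Boehmian on `U` to an open subset `V`: restrict the functions of a
representing sequence. -/
def Boehmian.restrict {N : ℕ} {U V : Opens (EuclideanSpace ℝ (Fin N))} (h : V ≤ U) :
    Boehmian U → Boehmian V :=
  Quotient.map (fun f => ⟨fun n => Boehmian.restrictFun h (f.1 n), f.2.restrict h⟩)
    fun _ _ hfg => Boehmian.Equivalent.restrict h hfg

namespace Boehmian

/-! Represent each `F i` by a fundamental sequence `f i`. On compact sets the limits of `f i k * δ`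
as `k → ∞` are honest continuous functions, and these can be glued. Exhaust each `U i` by compact
sets `K i n` and, for each `n`, take a single test function `δ n` for which all `f i k * δ n`
converge uniformly on `K i n`, while the differences for `i` and `j` tend to zero on `K i n ∩ K j
n`. The limits agree on overlaps, so they have a common continuous extension `G n` to the whole
space, and `(G n)` represents the required Boehmian.

Two points carry the proof. A common `δ n` exists because convergence survives further convolution:
convolving the functions suited to finitely many requirements yields one that suits them all.
`Admissible` abstracts this, with `Admissible.and` as its core. Secondly, `(f i k * δ n) * η = (f i
k * η) * δ n`, and convolution with `δ n` tends to the identity, so `G n * η` has the same limit as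
`f i k * η` (`tendstoUniformlyOn_convolution`). This gives both fundamentality of `(G n)` and its
equivalence to `f i` on `U i`. -/

/-- Convolution of real functions with respect to Lebesgue measure. -/
local notation:67 f:67 " ⋆ᵣ " g:68 =>
  convolution f g (ContinuousLinearMap.mul ℝ ℝ) volume

/-! ### Convolution with unit test functions -/

variable {N : ℕ}

theorem convolution_mul_comm (f g : EuclideanSpace ℝ (Fin N) → ℝ) : f ⋆ᵣ g = g ⋆ᵣ f := by
  rw [← convolution_flip]
  congr 1
  ext
  simp

theorem IsUnitTest.integrable {φ : EuclideanSpace ℝ (Fin N) → ℝ} (hφ : IsUnitTest φ) :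
    Integrable φ :=
  hφ.smooth.continuous.integrable_of_hasCompactSupport hφ.compactSupport

theorem convolution_mul_assoc {F φ ψ : EuclideanSpace ℝ (Fin N) → ℝ} (hF : Integrable F)
    (hφ : IsUnitTest φ) (hψ : IsUnitTest ψ) : F ⋆ᵣ φ ⋆ᵣ ψ = F ⋆ᵣ (φ ⋆ᵣ ψ) := by
  funext x
  exact convolution_assoc (ContinuousLinearMap.mul ℝ ℝ) (ContinuousLinearMap.mul ℝ ℝ)
    (ContinuousLinearMap.mul ℝ ℝ) (ContinuousLinearMap.mul ℝ ℝ) (μ := volume) (ν := volume)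
    (f := F) (g := φ) (k := ψ) (fun a b c => mul_assoc a b c) (x₀ := x)
    hF.aestronglyMeasurable hφ.smooth.continuous.aestronglyMeasurable
    hψ.smooth.continuous.aestronglyMeasurable
    (Eventually.of_forall (hφ.compactSupport.convolutionExists_right _ hF.locallyIntegrable
      hφ.smooth.continuous))
    (Eventually.of_forall (hψ.compactSupport.norm.convolutionExists_right _
      hφ.smooth.continuous.norm.locallyIntegrable hψ.smooth.continuous.norm))
    ((hφ.compactSupport.norm.convolution _ hψ.compactSupport.norm).convolutionExists_right _
      hF.norm.locallyIntegrable (hψ.compactSupport.norm.continuous_convolution_right _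
        hφ.smooth.continuous.norm.locallyIntegrable hψ.smooth.continuous.norm) x)

theorem continuous_convolution_unitTest {F φ : EuclideanSpace ℝ (Fin N) → ℝ}
    (hF : LocallyIntegrable F) (hφ : IsUnitTest φ) : Continuous (F ⋆ᵣ φ) :=
  hφ.compactSupport.continuous_convolution_right _ hF hφ.smooth.continuous

/-- Averaging against a unit test function does not increase uniform distances. -/
theorem abs_convolution_sub_le {u v φ : EuclideanSpace ℝ (Fin N) → ℝ} (hu : Continuous u)
    (hv : Continuous v) (hφ : IsUnitTest φ) {x : EuclideanSpace ℝ (Fin N)} {ε : ℝ}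
    (h : ∀ t ∈ tsupport φ, |u (x - t) - v (x - t)| ≤ ε) :
    |(u ⋆ᵣ φ) x - (v ⋆ᵣ φ) x| ≤ ε := by
  have hex : ∀ w : EuclideanSpace ℝ (Fin N) → ℝ, Continuous w →
      Integrable fun t => w (x - t) * φ t := fun w hw =>
    ((hw.comp (by fun_prop)).mul hφ.smooth.continuous).integrable_of_hasCompactSupport
      hφ.compactSupport.mul_left
  rw [convolution_eq_swap, convolution_eq_swap]
  change |(∫ t, u (x - t) * φ t) - ∫ t, v (x - t) * φ t| ≤ ε
  rw [← integral_sub (hex u hu) (hex v hv), ← Real.norm_eq_abs]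
  refine (norm_integral_le_of_norm_le (hφ.integrable.const_mul ε)
    (Eventually.of_forall fun t => ?_)).trans_eq (by
      rw [integral_const_mul, hφ.integral_eq_one, mul_one])
  rw [← sub_mul, norm_mul, Real.norm_of_nonneg (hφ.nonneg t), Real.norm_eq_abs]
  by_cases ht : t ∈ tsupport φ
  · exact mul_le_mul_of_nonneg_right (h t ht) (hφ.nonneg t)
  · simp [image_eq_zero_of_notMem_tsupport ht]

theorem const_convolution {φ : EuclideanSpace ℝ (Fin N) → ℝ} (hφ : IsUnitTest φ) (c : ℝ)
    (x : EuclideanSpace ℝ (Fin N)) : ((fun _ => c) ⋆ᵣ φ) x = c := by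
  rw [convolution_eq_swap]
  change ∫ t, c * φ t = c
  rw [integral_const_mul, hφ.integral_eq_one, mul_one]

theorem tsupport_convolution_subset_ball {φ ψ : EuclideanSpace ℝ (Fin N) → ℝ}
    (hφ : IsUnitTest φ) (hψ : IsUnitTest ψ) {a b r : ℝ} (ha : tsupport φ ⊆ Metric.ball 0 a)
    (hb : tsupport ψ ⊆ Metric.ball 0 b) (hr : a + b ≤ r) :
    tsupport (φ ⋆ᵣ ψ) ⊆ Metric.ball 0 r := by
  intro z hz
  obtain ⟨s, hs, t, ht, rfl⟩ := tsupport_convolution_subset hφ.compactSupport hψ.compactSupport hz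
  have h1 := mem_ball_zero_iff.1 (ha hs)
  have h2 := mem_ball_zero_iff.1 (hb ht)
  exact mem_ball_zero_iff.2 ((norm_add_le s t).trans_lt (by linarith))

theorem exists_isUnitTest (N : ℕ) {ε : ℝ} (hε : 0 < ε) :
    ∃ φ : EuclideanSpace ℝ (Fin N) → ℝ, IsUnitTest φ ∧ tsupport φ ⊆ Metric.ball 0 ε := by
  let b : ContDiffBump (0 : EuclideanSpace ℝ (Fin N)) :=
    ⟨ε / 4, ε / 2, by positivity, by linarith⟩
  refine ⟨b.normed volume, ⟨b.contDiff_normed, b.hasCompactSupport_normed, b.nonneg_normed,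
    b.integral_normed⟩, ?_⟩
  rw [b.tsupport_normed_eq]
  exact Metric.closedBall_subset_ball (by change ε / 2 < ε; linarith)

/-! ### Admissible properties and common delta sequences -/

/-- A property of test functions that holds for arbitrarily concentrated unit test functions and
persists under further convolution with concentrated unit test functions. -/
def Admissible (Q : (EuclideanSpace ℝ (Fin N) → ℝ) → Prop) : Prop :=
  ∃ r > 0, ∀ ε > 0, ∃ φ, IsUnitTest φ ∧ tsupport φ ⊆ Metric.ball 0 ε ∧
    ∀ ψ, IsUnitTest ψ → tsupport ψ ⊆ Metric.ball 0 r → Q (φ ⋆ᵣ ψ)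

theorem admissible_tsupport {ρ : ℝ} (hρ : 0 < ρ) :
    Admissible fun φ : EuclideanSpace ℝ (Fin N) → ℝ => tsupport φ ⊆ Metric.ball 0 ρ := by
  refine ⟨ρ / 2, by positivity, fun ε hε => ?_⟩
  obtain ⟨φ, hφ, hs⟩ := exists_isUnitTest N (show 0 < min ε (ρ / 2) by positivity)
  refine ⟨φ, hφ, hs.trans (Metric.ball_subset_ball (min_le_left _ _)), fun ψ hψ hsψ =>
    tsupport_convolution_subset_ball hφ hψ (hs.trans (Metric.ball_subset_ball (min_le_right _ _)))
      hsψ (by linarith)⟩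

/-- If `φ` serves `P` and `χ` serves `Q`, then `φ ⋆ᵣ χ` serves both: `(φ ⋆ᵣ χ) ⋆ᵣ ψ` equals `φ ⋆ᵣ (χ
⋆ᵣ ψ)` and `χ ⋆ᵣ (φ ⋆ᵣ ψ)`. The halved radii keep the inner convolutions within the balls of radius
`r` and `s`. -/
theorem Admissible.and {P Q : (EuclideanSpace ℝ (Fin N) → ℝ) → Prop} (hP : Admissible P)
    (hQ : Admissible Q) : Admissible fun φ => P φ ∧ Q φ := by
  obtain ⟨r, hr, hP⟩ := hP
  obtain ⟨s, hs, hQ⟩ := hQ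
  refine ⟨min (r / 2) (s / 2), by positivity, fun ε hε => ?_⟩
  obtain ⟨φ, hφ, hφs, hφP⟩ := hP (min (ε / 2) (s / 2)) (by positivity)
  obtain ⟨χ, hχ, hχs, hχQ⟩ := hQ (min (ε / 2) (r / 2)) (by positivity)
  have e1 := min_le_left (ε / 2) (s / 2)
  have e2 := min_le_right (ε / 2) (s / 2)
  have e3 := min_le_left (ε / 2) (r / 2)
  have e4 := min_le_right (ε / 2) (r / 2)
  have e5 := min_le_left (r / 2) (s / 2)
  have e6 := min_le_right (r / 2) (s / 2)
  refine ⟨φ ⋆ᵣ χ, hφ.convolution_right hχ,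
    tsupport_convolution_subset_ball hφ hχ hφs hχs (by linarith), fun ψ hψ hψs => ⟨?_, ?_⟩⟩
  · rw [convolution_mul_assoc hφ.integrable hχ hψ]
    exact hφP _ (hχ.convolution_right hψ)
      (tsupport_convolution_subset_ball hχ hψ hχs hψs (by linarith))
  · rw [convolution_mul_comm φ χ, convolution_mul_assoc hχ.integrable hφ hψ]
    exact hχQ _ (hφ.convolution_right hψ)
      (tsupport_convolution_subset_ball hφ hψ hφs hψs (by linarith))

theorem Admissible.mono {P Q : (EuclideanSpace ℝ (Fin N) → ℝ) → Prop} (hP : Admissible P)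
    (h : ∀ φ, P φ → Q φ) : Admissible Q := by
  obtain ⟨r, hr, hP⟩ := hP
  refine ⟨r, hr, fun ε hε => ?_⟩
  obtain ⟨φ, hφ, hs, H⟩ := hP ε hε
  exact ⟨φ, hφ, hs, fun ψ h1 h2 => h _ (H ψ h1 h2)⟩

/-- The finiteness of the family of open sets enters here, since only finitely many test functions
can be convolved together. -/
theorem admissible_forall {ι : Type*} [Finite ι]
    {Q : ι → (EuclideanSpace ℝ (Fin N) → ℝ) → Prop} (hQ : ∀ i, Admissible (Q i)) :
    Admissible fun φ => ∀ i, Q i φ := by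
  classical
  cases nonempty_fintype ι
  suffices ∀ s : Finset ι, Admissible fun φ => ∀ i ∈ s, Q i φ from
    (this Finset.univ).mono fun φ h i => h i (Finset.mem_univ i)
  intro s
  induction s using Finset.induction_on with
  -- With no requirement to meet, any admissible property will do.
  | empty => exact (admissible_tsupport one_pos).mono fun φ _ i hi => by simp at hi
  | insert a s _ ih =>
    refine ((hQ a).and ih).mono fun φ h i hi => ?_
    rcases Finset.mem_insert.1 hi with rfl | hi
    · exact h.1
    · exact h.2 i hi

theorem Admissible.exists_isUnitTest {Q : (EuclideanSpace ℝ (Fin N) → ℝ) → Prop}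
    (hQ : Admissible Q) {ε : ℝ} (hε : 0 < ε) :
    ∃ φ, IsUnitTest φ ∧ tsupport φ ⊆ Metric.ball 0 ε ∧ Q φ := by
  obtain ⟨r, hr, hP⟩ := hQ.and (admissible_tsupport hε)
  obtain ⟨φ, hφ, hs, H⟩ := hP r hr
  exact ⟨φ ⋆ᵣ φ, hφ.convolution_right hφ, (H φ hφ hs).2, (H φ hφ hs).1⟩

/-- The requirement may vary with `n`, which allows the compact sets to grow along the delta
sequence. -/
theorem exists_isDelta_of_admissible {Q : ℕ → (EuclideanSpace ℝ (Fin N) → ℝ) → Prop}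
    (hQ : ∀ n, Admissible (Q n)) : ∃ δ, IsDelta δ ∧ ∀ n, Q n (δ n) := by
  choose δ hδ hs hδQ using fun n : ℕ =>
    (hQ n).exists_isUnitTest (show (0 : ℝ) < 1 / ((n : ℝ) + 1) by positivity)
  exact ⟨δ, ⟨hδ, squeeze_zero (fun n => suppRadius_nonneg _)
    (fun n => suppRadius_le (by positivity) (hs n)) tendsto_one_div_add_atTop_nhds_zero_nat⟩, hδQ⟩

/-! ### Admissibility from fundamental and equivalent sequences -/

variable {U : Opens (EuclideanSpace ℝ (Fin N))}

theorem conv_sub (f g : C(U, ℝ)) {φ : EuclideanSpace ℝ (Fin N) → ℝ} (hφ : IsUnitTest φ)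
    {K : Set (EuclideanSpace ℝ (Fin N))} (hd : ConvDefinedOn U φ K)
    {x : EuclideanSpace ℝ (Fin N)} (hx : x ∈ K) :
    conv (f - g) φ x = conv f φ x - conv g φ x := by
  rw [sub_eq_add_neg, conv_add f (-g) hφ (x := x) (by rintro _ rfl; exact hd _ hx),
    conv_neg g φ hd hx, sub_eq_add_neg]

theorem sub_mem_cthickening {K : Set (EuclideanSpace ℝ (Fin N))} {r : ℝ}
    {x t : EuclideanSpace ℝ (Fin N)} (hx : x ∈ K) (ht : t ∈ Metric.ball 0 r) :
    x - t ∈ Metric.cthickening r K := by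
  refine Metric.mem_cthickening_of_dist_le (x - t) x r K hx ?_
  rw [dist_eq_norm, sub_sub_cancel_left, norm_neg]
  exact (mem_ball_zero_iff.1 ht).le

theorem ConvDefinedOn.mono {φ : EuclideanSpace ℝ (Fin N) → ℝ}
    {K L : Set (EuclideanSpace ℝ (Fin N))} (h : ConvDefinedOn U φ K) (hLK : L ⊆ K) :
    ConvDefinedOn U φ L := fun x hx => h x (hLK hx)

theorem ConvDefinedOn.mono_left {V : Opens (EuclideanSpace ℝ (Fin N))}
    {φ : EuclideanSpace ℝ (Fin N) → ℝ} {K : Set (EuclideanSpace ℝ (Fin N))}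
    (h : ConvDefinedOn U φ K) (hUV : U ≤ V) : ConvDefinedOn V φ K :=
  fun x hx y hy => hUV (h x hx y hy)

theorem ConvDefinedOn.convolution_right {φ ψ : EuclideanSpace ℝ (Fin N) → ℝ}
    {K : Set (EuclideanSpace ℝ (Fin N))} {r : ℝ} (hφ : IsUnitTest φ) (hψ : IsUnitTest ψ)
    (h : ConvDefinedOn U φ (Metric.cthickening r K)) (hs : tsupport ψ ⊆ Metric.ball 0 r) :
    ConvDefinedOn U (φ ⋆ᵣ ψ) K := by
  intro x hx z hz
  obtain ⟨a, ha, b, hb, rfl⟩ := tsupport_convolution_subset hφ.compactSupport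
    hψ.compactSupport hz
  have := h _ (sub_mem_cthickening hx (hs hb)) a ha
  rwa [sub_sub, add_comm b a] at this

/-- Fundamentality on a thickening of `K` leaves room for averaging: `f n * (δ m * ψ)` on `K` only
involves `f n * δ m` on the thickening, and averaging against `ψ` does not increase uniform bounds.
-/
theorem IsFundamental.admissible {f : ℕ → C(U, ℝ)} (hf : IsFundamental f)
    {K : Set (EuclideanSpace ℝ (Fin N))} (hK : IsCompact K) (hKU : K ⊆ U) :
    Admissible fun φ => ConvDefinedOn U φ K ∧
      UniformCauchySeqOn (fun n => conv (f n) φ) atTop K := by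
  obtain ⟨r, hr, hrU⟩ := hK.exists_cthickening_subset_open U.isOpen hKU
  obtain ⟨δ, hδ, hc⟩ := hf _ hK.cthickening hrU
  refine ⟨r, hr, fun ε hε => ?_⟩
  obtain ⟨m, hm⟩ := (hδ.eventually_tsupport hε).exists
  refine ⟨δ m, hδ.unitTest m, hm, fun ψ hψ hs => ?_⟩
  obtain ⟨hd, g, hg⟩ := hc m
  have hd' := hd.convolution_right (hδ.unitTest m) hψ hs
  refine ⟨hd', Metric.uniformCauchySeqOn_iff.2 fun ε hε => ?_⟩
  obtain ⟨n₀, hn₀⟩ := Metric.uniformCauchySeqOn_iff.1 hg.uniformCauchySeqOn (ε / 2)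
    (by positivity)
  refine ⟨n₀, fun k hk l hl x hx => ?_⟩
  rw [Real.dist_eq, ← conv_sub _ _ ((hδ.unitTest m).convolution_right hψ) hd' hx]
  refine (abs_conv_convolution_le _ (hδ.unitTest m) hψ hK.cthickening hd
    (fun t ht => sub_mem_cthickening hx (hs ht)) (ε := ε / 2) fun y hy => ?_).trans_lt
      (by linarith)
  rw [conv_sub _ _ (hδ.unitTest m) hd hy]
  exact (hn₀ k hk l hl y hy).le

theorem Equivalent.admissible {f g : ℕ → C(U, ℝ)} (hfg : Equivalent f g)
    {K : Set (EuclideanSpace ℝ (Fin N))} (hK : IsCompact K) (hKU : K ⊆ U) :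
    Admissible fun φ => ConvDefinedOn U φ K ∧
      TendstoUniformlyOn (fun n => conv (f n - g n) φ) 0 atTop K := by
  obtain ⟨r, hr, hrU⟩ := hK.exists_cthickening_subset_open U.isOpen hKU
  obtain ⟨δ, hδ, hc⟩ := hfg _ hK.cthickening hrU
  refine ⟨r, hr, fun ε hε => ?_⟩
  obtain ⟨m, hm⟩ := (hδ.eventually_tsupport hε).exists
  refine ⟨δ m, hδ.unitTest m, hm, fun ψ hψ hs => ?_⟩
  obtain ⟨hd, hg⟩ := hc m
  refine ⟨hd.convolution_right (hδ.unitTest m) hψ hs, Metric.tendstoUniformlyOn_iff.2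
    fun ε hε => ?_⟩
  filter_upwards [Metric.tendstoUniformlyOn_iff.1 hg (ε / 2) (by positivity)] with n hn x hx
  have := abs_conv_convolution_le (f n - g n) (hδ.unitTest m) hψ hK.cthickening hd
    (fun t ht => sub_mem_cthickening hx (hs ht)) (ε := ε / 2)
    fun y hy => by simpa using (hn y hy).le
  simpa using this.trans_lt (half_lt_self hε)

/-! ### Limits of regularized sequences -/

/-- Replaces a function known only on `U` by an integrable one on the whole space, for which
convolution is associative. One `F` serves all `φ` supported in `S`, so different test functions can
be interchanged. -/
theorem exists_convolution_eq (f : C(U, ℝ)) {S : Set (EuclideanSpace ℝ (Fin N))}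
    (hS : IsCompact S) {K : Set (EuclideanSpace ℝ (Fin N))} (hK : IsCompact K)
    (hd : ∀ x ∈ K, ∀ y ∈ S, x - y ∈ U) :
    ∃ F : EuclideanSpace ℝ (Fin N) → ℝ, Integrable F ∧
      ∀ φ, tsupport φ ⊆ S → ∀ x ∈ K, (F ⋆ᵣ φ) x = conv f φ x := by
  obtain ⟨F, hF, hFe⟩ := exists_integrable_eq f
    (L := Set.image2 (fun a b => a - b) K S) (by
      rw [← Set.image_prod]
      exact (hK.prod hS).image (by fun_prop)) (by
      rintro _ ⟨a, ha, b, hb, rfl⟩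
      exact hd a ha b hb)
  exact ⟨F, hF, fun φ hφ x hx => convolution_congr_on fun t ht => hFe _ ⟨x, hx, t, hφ ht, rfl⟩⟩

theorem continuousOn_conv (f : C(U, ℝ)) {φ : EuclideanSpace ℝ (Fin N) → ℝ} (hφ : IsUnitTest φ)
    {K : Set (EuclideanSpace ℝ (Fin N))} (hK : IsCompact K) (hd : ConvDefinedOn U φ K) :
    ContinuousOn (conv f φ) K := by
  obtain ⟨F, hF, hFe⟩ := exists_convolution_eq f hφ.compactSupport.isCompact hK hd
  exact (continuous_convolution_unitTest hF.locallyIntegrable hφ).continuousOn.congr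
    fun x hx => (hFe φ subset_rfl x hx).symm

theorem exists_tendstoUniformlyOn {α : Type*} {u : ℕ → α → ℝ} {K : Set α}
    (h : UniformCauchySeqOn u atTop K) : ∃ g, TendstoUniformlyOn u g atTop K := by
  classical
  have hex : ∀ x, ∃ l, x ∈ K → Tendsto (fun n => u n x) atTop (𝓝 l) := fun x => by
    by_cases hx : x ∈ K
    · exact (cauchySeq_tendsto_of_complete (h.cauchySeq hx)).imp fun l hl _ => hl
    · exact ⟨0, fun h => absurd h hx⟩
  choose g hg using hex
  exact ⟨g, h.tendstoUniformlyOn_of_tendsto hg⟩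

theorem exists_compact_exhaustion (U : Opens (EuclideanSpace ℝ (Fin N))) :
    ∃ K : ℕ → Set (EuclideanSpace ℝ (Fin N)), (∀ n, IsCompact (K n)) ∧ (∀ n, K n ⊆ U) ∧
      ∀ L, IsCompact L → L ⊆ U → ∀ᶠ n in atTop, L ⊆ K n := by
  have : LocallyCompactSpace U := U.isOpen.locallyCompactSpace
  let K : CompactExhaustion U := CompactExhaustion.choice U
  refine ⟨fun n => Subtype.val '' K n, fun n => (K.isCompact n).image continuous_subtype_val,
    fun n => by rintro _ ⟨x, _, rfl⟩; exact x.2, fun L hL hLU => ?_⟩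
  have hL' : IsCompact (Subtype.val ⁻¹' L : Set U) :=
    Topology.IsInducing.subtypeVal.isCompact_preimage_iff (by simpa using hLU) |>.2 hL
  obtain ⟨n, hn⟩ := K.exists_superset_of_isCompact hL'
  filter_upwards [eventually_ge_atTop n] with m hm x hx
  exact ⟨⟨x, hLU hx⟩, K.subset hm (hn hx), rfl⟩

/-- If `g n` is, on the `n`-th set of an exhaustion, the limit of `f k * δ n` as `k → ∞`, then
`g n * η` has the same limit as `f k * η`. -/
theorem tendstoUniformlyOn_convolution {f : ℕ → C(U, ℝ)}
    {δ g : ℕ → EuclideanSpace ℝ (Fin N) → ℝ} {K : ℕ → Set (EuclideanSpace ℝ (Fin N))}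
    (hδ : IsDelta δ) (hK : ∀ L, IsCompact L → L ⊆ U → ∀ᶠ n in atTop, L ⊆ K n)
    (hd : ∀ n, ConvDefinedOn U (δ n) (K n)) (hgc : ∀ n, Continuous (g n))
    (hg : ∀ n, TendstoUniformlyOn (fun k => conv (f k) (δ n)) (g n) atTop (K n))
    {η h : EuclideanSpace ℝ (Fin N) → ℝ} (hη : IsUnitTest η)
    {L : Set (EuclideanSpace ℝ (Fin N))} (hL : IsCompact L) {r : ℝ}
    (hLU : Metric.cthickening r L ⊆ U) (hr : 0 < r) (hηr : tsupport η ⊆ Metric.ball 0 r)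
    (hηd : ConvDefinedOn U η (Metric.cthickening r L))
    (hh : TendstoUniformlyOn (fun k => conv (f k) η) h atTop (Metric.cthickening r L)) :
    TendstoUniformlyOn (fun n => g n ⋆ᵣ η) h atTop L := by
  have hL' : IsCompact (Metric.cthickening r L) := hL.cthickening
  have hhc : ContinuousOn h (Metric.cthickening r L) := hh.continuousOn
    (Frequently.of_forall fun k => continuousOn_conv (f k) hη hL' hηd)
  have huc := Metric.uniformContinuousOn_iff.1 (hL'.uniformContinuousOn_of_continuous hhc)
  refine Metric.tendstoUniformlyOn_iff.2 fun ε hε => ?_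
  obtain ⟨d, hd0, hdε⟩ := huc (ε / 4) (by positivity)
  filter_upwards [hK _ hL' hLU,
    hδ.eventually_tsupport (show 0 < min d r by positivity)] with n hnK hnδ x hx
  -- With `n` fixed, a single `k` makes `f k * δ n` close to `g n` and `f k * η` close to `h` on the
  -- thickening; `k` may depend on `n`.
  obtain ⟨k, hk1, hk2⟩ := ((Metric.tendstoUniformlyOn_iff.1 ((hg n).mono hnK) (ε / 4)
    (by positivity)).and (Metric.tendstoUniformlyOn_iff.1 hh (ε / 4) (by positivity))).exists
  have hδn := hδ.unitTest n
  obtain ⟨F, hF, hFe⟩ := exists_convolution_eq (f k)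
    (hδn.compactSupport.isCompact.union hη.compactSupport.isCompact) hL' (by
      rintro y hy z (hz | hz)
      · exact hd n y (hnK hy) z hz
      · exact hηd y hy z hz)
  have hswap : F ⋆ᵣ δ n ⋆ᵣ η = F ⋆ᵣ η ⋆ᵣ δ n := by
    rw [convolution_mul_assoc hF hδn hη, convolution_mul_comm (δ n),
      convolution_mul_assoc hF hη hδn]
  have h1 : |(g n ⋆ᵣ η) x - (F ⋆ᵣ δ n ⋆ᵣ η) x| ≤ ε / 4 := by
    refine abs_convolution_sub_le (hgc n)
      (continuous_convolution_unitTest hF.locallyIntegrable hδn) hη fun t ht => ?_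
    have hm := sub_mem_cthickening hx (hηr ht)
    rw [hFe _ Set.subset_union_left _ hm]
    exact (hk1 _ hm).le
  have h2 : |(F ⋆ᵣ η ⋆ᵣ δ n) x - h x| ≤ ε / 2 := by
    -- Writing `h x` as a constant function convolved with `δ n` reduces the claim to comparing `F
    -- ⋆ᵣ η` with `h x` near `x`, where uniform continuity of `h` applies.
    rw [← const_convolution hδn (h x) x]
    refine abs_convolution_sub_le
      (continuous_convolution_unitTest hF.locallyIntegrable hη) continuous_const hδn
      fun t ht => ?_
    have htn := mem_ball_zero_iff.1 (hnδ ht)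
    have hm : x - t ∈ Metric.cthickening r L :=
      sub_mem_cthickening hx (mem_ball_zero_iff.2 (htn.trans_le (min_le_right _ _)))
    rw [hFe _ Set.subset_union_right _ hm]
    have e1 := hk2 _ hm
    have e2 := hdε _ hm _ (Metric.self_subset_cthickening L hx) (by
      rw [dist_eq_norm, sub_sub_cancel_left, norm_neg]
      exact htn.trans_le (min_le_left _ _))
    rw [dist_comm, Real.dist_eq] at e1
    rw [Real.dist_eq] at e2
    exact (abs_sub_le _ (h (x - t)) _).trans (by linarith)
  rw [hswap] at h1
  rw [dist_comm, Real.dist_eq]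
  exact (abs_sub_le _ ((F ⋆ᵣ η ⋆ᵣ δ n) x) _).trans_lt (by linarith)

/-! ### Gluing the regularizations -/

/-- Continuous functions on finitely many closed sets that agree on the overlaps have a common
continuous extension. -/
theorem exists_continuous_extension {X ι : Type*} [TopologicalSpace X] [NormalSpace X] [Finite ι]
    {K : ι → Set X} (hK : ∀ i, IsClosed (K i)) {g : ι → X → ℝ}
    (hg : ∀ i, ContinuousOn (g i) (K i))
    (hagree : ∀ i j, ∀ x ∈ K i, x ∈ K j → g i x = g j x) :
    ∃ G : C(X, ℝ), ∀ i, Set.EqOn (g i) G (K i) := by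
  classical
  -- By `hagree` the chosen index does not matter; the value `0` off the union is never used.
  let u : X → ℝ := fun x => if h : ∃ i, x ∈ K i then g h.choose x else 0
  have hu : ∀ i, Set.EqOn (g i) u (K i) := fun i x hx => by
    have h : ∃ i, x ∈ K i := ⟨i, hx⟩
    simp only [u, dif_pos h]
    exact hagree _ _ x hx h.choose_spec
  have huc : ContinuousOn u (⋃ i, K i) := (locallyFinite_of_finite K).continuousOn_iUnion hK
    fun i => (hg i).congr (hu i).symm
  -- Tietze's theorem on the closed union.
  obtain ⟨G, hG⟩ := ContinuousMap.exists_restrict_eq (isClosed_iUnion_of_finite hK)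
    ⟨_, huc.domRestrict⟩
  exact ⟨G, fun i x hx => (hu i hx).trans
    (DFunLike.congr_fun hG ⟨x, Set.mem_iUnion_of_mem i hx⟩).symm⟩

variable {ι : Type*} [Finite ι] {U : ι → Opens (EuclideanSpace ℝ (Fin N))}
  {f : ∀ i, ℕ → C(U i, ℝ)}

/-- Regularizing locally compatible fundamental sequences by a common delta sequence gives
continuous functions that agree on overlaps, hence globally defined continuous functions. -/
theorem exists_common_regularization (hf : ∀ i, IsFundamental (f i))
    (hfe : ∀ i j, Equivalent
      (fun k => restrictFun (inf_le_left : U i ⊓ U j ≤ U i) (f i k))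
      (fun k => restrictFun (inf_le_right : U i ⊓ U j ≤ U j) (f j k)))
    {K : ι → ℕ → Set (EuclideanSpace ℝ (Fin N))} (hK : ∀ i n, IsCompact (K i n))
    (hKU : ∀ i n, K i n ⊆ U i) :
    ∃ (δ : ℕ → EuclideanSpace ℝ (Fin N) → ℝ) (G : ℕ → C(EuclideanSpace ℝ (Fin N), ℝ)),
      IsDelta δ ∧ ∀ i n, ConvDefinedOn (U i) (δ n) (K i n) ∧
        TendstoUniformlyOn (fun k => conv (f i k) (δ n)) (G n) atTop (K i n) := by
  obtain ⟨δ, hδ, hQ⟩ := exists_isDelta_of_admissible fun n : ℕ =>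
    (admissible_forall fun i => (hf i).admissible (hK i n) (hKU i n)).and
      (admissible_forall fun p : ι × ι => (hfe p.1 p.2).admissible
        ((hK p.1 n).inter (hK p.2 n)) (Set.inter_subset_inter (hKU p.1 n) (hKU p.2 n)))
  choose g hg using fun n i => exists_tendstoUniformlyOn ((hQ n).1 i).2
  have hex : ∀ n, ∃ G : C(EuclideanSpace ℝ (Fin N), ℝ), ∀ i, Set.EqOn (g n i) G (K i n) := by
    refine fun n => exists_continuous_extension (fun i => (hK i n).isClosed)
      (fun i => (hg n i).continuousOn (Frequently.of_forall fun k =>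
        continuousOn_conv (f i k) (hδ.unitTest n) (hK i n) ((hQ n).1 i).1))
      fun i j x hxi hxj => ?_
    obtain ⟨hd, h0⟩ := (hQ n).2 (i, j)
    have hx : x ∈ K i n ∩ K j n := ⟨hxi, hxj⟩
    have hlim := ((hg n i).tendsto_at hxi).sub ((hg n j).tendsto_at hxj)
    -- The difference of the two limits is the limit of `conv` of the differences of the
    -- restrictions, which is zero by equivalence on the overlap.
    refine sub_eq_zero.1 (tendsto_nhds_unique (hlim.congr fun k => ?_) (h0.tendsto_at hx))
    rw [conv_sub _ _ (hδ.unitTest n) hd hx, conv_restrictFun _ _ hd hx,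
      conv_restrictFun _ _ hd hx]
  choose G hG using hex
  exact ⟨δ, G, hδ, fun i n => ⟨((hQ n).1 i).1, (hg n i).congr_right (hG n i)⟩⟩

/-- The glued functions have, after convolution with suitable test functions, the same limits as
the given fundamental sequences. -/
theorem exists_glued_sequence (hf : ∀ i, IsFundamental (f i))
    (hfe : ∀ i j, Equivalent
      (fun k => restrictFun (inf_le_left : U i ⊓ U j ≤ U i) (f i k))
      (fun k => restrictFun (inf_le_right : U i ⊓ U j ≤ U j) (f j k))) :
    ∃ G : ℕ → C(EuclideanSpace ℝ (Fin N), ℝ), ∀ i (L : Set (EuclideanSpace ℝ (Fin N))),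
      IsCompact L → L ⊆ U i → Admissible fun η => IsUnitTest η → ConvDefinedOn (U i) η L ∧
        ∃ h : EuclideanSpace ℝ (Fin N) → ℝ,
          TendstoUniformlyOn (fun k => conv (f i k) η) h atTop L ∧
          TendstoUniformlyOn (fun n => ⇑(G n) ⋆ᵣ η) h atTop L := by
  choose K hK hKU hKL using fun i => exists_compact_exhaustion (U i)
  obtain ⟨δ, G, hδ, hG⟩ := exists_common_regularization hf hfe hK hKU
  refine ⟨G, fun i L hL hLU => ?_⟩
  obtain ⟨r, hr, hrU⟩ := hL.exists_cthickening_subset_open (U i).isOpen hLU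
  -- The predicate in `Admissible` does not record that `η` is a unit test function, so this is
  -- carried as a premise inside it.
  refine (((hf i).admissible hL.cthickening hrU).and (admissible_tsupport hr)).mono ?_
  rintro η ⟨⟨hd, hc⟩, hs⟩ hη
  obtain ⟨h, hh⟩ := exists_tendstoUniformlyOn hc
  have hsub := Metric.self_subset_cthickening (δ := r) L
  exact ⟨hd.mono hsub, h, hh.mono hsub, tendstoUniformlyOn_convolution hδ (hKL i)
    (fun n => (hG i n).1) (fun n => (G n).continuous) (fun n => (hG i n).2) hη hL hrU hr hs hd hh⟩

/-! ### The glued sequence on the union -/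

/-- Restriction of a globally defined continuous function to an open set. -/
def restrictOpen (V : Opens (EuclideanSpace ℝ (Fin N))) (g : C(EuclideanSpace ℝ (Fin N), ℝ)) :
    C(V, ℝ) :=
  g.comp ⟨Subtype.val, continuous_subtype_val⟩

theorem conv_restrictOpen {V : Opens (EuclideanSpace ℝ (Fin N))}
    (g : C(EuclideanSpace ℝ (Fin N), ℝ)) {φ : EuclideanSpace ℝ (Fin N) → ℝ}
    {K : Set (EuclideanSpace ℝ (Fin N))} (hd : ConvDefinedOn V φ K)
    {x : EuclideanSpace ℝ (Fin N)} (hx : x ∈ K) :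
    conv (restrictOpen V g) φ x = (⇑g ⋆ᵣ φ) x :=
  convolution_congr_on fun y hy => extend_of_mem _ (hd x hx y hy)

/-- A compact subset of the union splits into finitely many compact pieces `L i ⊆ U i`, and one
delta sequence serves all of them. Being uniformly Cauchy on each piece gives the same on `K`,
without gluing the limits `h`. -/
theorem isFundamental_restrictOpen_iSup {G : ℕ → C(EuclideanSpace ℝ (Fin N), ℝ)}
    (hG : ∀ i (L : Set (EuclideanSpace ℝ (Fin N))), IsCompact L → L ⊆ U i →
      Admissible fun η => IsUnitTest η → ConvDefinedOn (U i) η L ∧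
        ∃ h : EuclideanSpace ℝ (Fin N) → ℝ,
          TendstoUniformlyOn (fun n => ⇑(G n) ⋆ᵣ η) h atTop L) :
    IsFundamental fun n => restrictOpen (⨆ i, U i) (G n) := by
  intro K hK hKU
  cases nonempty_fintype ι
  obtain ⟨L, hL, hLU, hKL⟩ := hK.finite_compact_cover Finset.univ (fun i => (U i : Set _))
    (fun i _ => (U i).isOpen) (by simpa using hKU)
  obtain ⟨η, hη, hQ⟩ := exists_isDelta_of_admissible fun _ : ℕ =>
    admissible_forall fun i => hG i (L i) (hL i) (hLU i)
  have hmem : ∀ x ∈ K, ∃ i, x ∈ L i := fun x hx => by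
    simpa using hKL.subset hx
  refine ⟨η, hη, fun m => ?_⟩
  have hd : ConvDefinedOn (⨆ i, U i) (η m) K := fun x hx y hy => by
    obtain ⟨i, hi⟩ := hmem x hx
    exact le_iSup U i ((hQ m i (hη.unitTest m)).1 x hi y hy)
  refine ⟨hd, exists_tendstoUniformlyOn (Metric.uniformCauchySeqOn_iff.2 fun ε hε => ?_)⟩
  choose n₀ hn₀ using fun i => Metric.uniformCauchySeqOn_iff.1
    (hQ m i (hη.unitTest m)).2.choose_spec.uniformCauchySeqOn ε hε
  refine ⟨Finset.univ.sup n₀, fun k hk l hl x hx => ?_⟩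
  obtain ⟨i, hi⟩ := hmem x hx
  have hle : n₀ i ≤ Finset.univ.sup n₀ := Finset.le_sup (Finset.mem_univ i)
  rw [conv_restrictOpen _ hd hx, conv_restrictOpen _ hd hx]
  exact hn₀ i k (hle.trans hk) l (hle.trans hl) x hi

/-- Both sequences, convolved with `η`, converge to the same `h` uniformly on `L`, so their
difference tends to zero there. -/
theorem equivalent_restrictFun_restrictOpen {V W : Opens (EuclideanSpace ℝ (Fin N))} (hVW : V ≤ W)
    {u : ℕ → C(V, ℝ)} {G : ℕ → C(EuclideanSpace ℝ (Fin N), ℝ)}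
    (hG : ∀ L : Set (EuclideanSpace ℝ (Fin N)), IsCompact L → L ⊆ V →
      Admissible fun η => IsUnitTest η → ConvDefinedOn V η L ∧
        ∃ h : EuclideanSpace ℝ (Fin N) → ℝ,
          TendstoUniformlyOn (fun k => conv (u k) η) h atTop L ∧
          TendstoUniformlyOn (fun n => ⇑(G n) ⋆ᵣ η) h atTop L) :
    Equivalent (fun n => restrictFun hVW (restrictOpen W (G n))) u := by
  intro L hL hLV
  obtain ⟨η, hη, hQ⟩ := exists_isDelta_of_admissible fun _ : ℕ => hG L hL hLV
  refine ⟨η, hη, fun m => ?_⟩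
  obtain ⟨hd, h, hu, hGh⟩ := hQ m (hη.unitTest m)
  refine ⟨hd, Metric.tendstoUniformlyOn_iff.2 fun ε hε => ?_⟩
  filter_upwards [Metric.tendstoUniformlyOn_iff.1 hu (ε / 2) (by positivity),
    Metric.tendstoUniformlyOn_iff.1 hGh (ε / 2) (by positivity)] with n h1 h2 x hx
  rw [conv_sub _ _ (hη.unitTest m) hd hx, conv_restrictFun hVW _ hd hx,
    conv_restrictOpen _ (hd.mono_left hVW) hx, Pi.zero_apply, dist_zero_left, Real.norm_eq_abs,
    ← Real.dist_eq]
  exact (dist_triangle_left _ _ (h x)).trans_lt (by linarith [h1 x hx, h2 x hx])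

end Boehmian

theorem mainTheorem5 (N n : ℕ) (U : Fin n → Opens (EuclideanSpace ℝ (Fin N)))
    (F : ∀ i, Boehmian (U i))
    (hF : ∀ i j, (F i).restrict (inf_le_left : U i ⊓ U j ≤ U i) =
      (F j).restrict (inf_le_right : U i ⊓ U j ≤ U j)) :
    ∃ G : Boehmian (⨆ i, U i), ∀ i, G.restrict (le_iSup U i) = F i := by
  choose f hf using fun i => Quotient.exists_rep (F i)
  have hfe : ∀ i j, Boehmian.Equivalent
      (fun k => Boehmian.restrictFun (inf_le_left : U i ⊓ U j ≤ U i) ((f i).1 k))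
      (fun k => Boehmian.restrictFun (inf_le_right : U i ⊓ U j ≤ U j) ((f j).1 k)) := by
    intro i j
    have h := hF i j
    rw [← hf i, ← hf j] at h
    exact Quotient.exact h
  obtain ⟨G, hG⟩ := Boehmian.exists_glued_sequence (fun i => (f i).2) hfe
  refine ⟨Quotient.mk _ ⟨_, Boehmian.isFundamental_restrictOpen_iSup fun i L hL hLU =>
    (hG i L hL hLU).mono fun η h hη => ⟨(h hη).1, (h hη).2.imp fun _ h => h.2⟩⟩, fun i => ?_⟩
  rw [← hf i]
  exact Quotient.sound (Boehmian.equivalent_restrictFun_restrictOpen (le_iSup U i) (hG i))
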